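/- Let $A\in\mathbb R^{n\times n}$, $n\ge 1$, be an irreducible singular M-matrix (i.e. $A=sI-C$ with $C\ge 0$ entrywise, $s>0$, $\rho(C)\le s$, and $\det A=0$) in lower Hessenberg form ($A_{ij}=0$ for $j>i+1$). Then $A$ can be normalized: there are diagonal matrices $D,E$ with positive diagonals such that $DAE=I-T$ with $T$ column stochastic. Let $A$ be replaced by any such normalization $DAE$ (by $A$ itself, if $A=I-T$ already), let $A_{n-1}$ be its leading principal submatrix of order $n-1$, let $\mathbf e$ be the vector of ones, and put \[ L=\begin{bmatrix} I_{n-1} & 0\\ \mathbf e^T & 1\end{bmatrix},\qquad M'_X=L^{-1}\begin{bmatrix} K_X & 0\\ 0^T & 1\end{bmatrix},\qquad N'_X=M'_X-A , \] where $K_J=\operatorname{diag}(A_{n-1})$ is the diagonal part, $K_{GS}=\operatorname{tril}(A_{n-1})$ and $K_{AGS}=\operatorname{triu}(A_{n-1})$ are the lower and upper triangular parts (with the diagonal), and $K_S=\mathcal S(A_{n-1})$ is the stair matrix of first or of second order, that is, the tridiagonal part of $A_{n-1}$ in which the off-diagonal entries of all odd-numbered rows (first order) or of all even-numbered rows (second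 order) are replaced by $0$. For a square matrix $P$ let $\gamma(P)=\max\{|\lambda| : \lambda\in\sigma(P),\ \lambda\ne 1\}$, with $\gamma(P)=0$ if there is no such $\lambda$. Then all the matrices $M'_X$ are invertible and, for either order of the stair matrix, \[ \gamma({M'_J}^{-1}N'_J)\ \ge\ \gamma({M'_{GS}}^{-1}N'_{GS})\ \ge\ \gamma({M'_S}^{-1}N'_S)\ \ge\ \gamma({M'_{AGS}}^{-1}N'_{AGS}). \] -/

import Mathlib

namespace HessenbergSplitting

/-- `A` is an M-matrix: `A = s I - C` with `C ≥ 0` entrywise, `s > 0` and `ρ(C) ≤ s`.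
Singular M-matrices are allowed. -/
def IsMMatrix {n : ℕ} (A : Matrix (Fin n) (Fin n) ℝ) : Prop :=
  ∃ (s : ℝ) (C : Matrix (Fin n) (Fin n) ℝ), 0 < s ∧ (∀ i j, 0 ≤ C i j) ∧
    spectralRadius ℂ (C.map (algebraMap ℝ ℂ)) ≤ ENNReal.ofReal s ∧
    A = s • (1 : Matrix (Fin n) (Fin n) ℝ) - C

/-- `A` is irreducible: no symmetric permutation of rows and columns brings it to block triangular
form, that is, there is no nonempty proper set `S` of indices such that `A i j = 0` whenever
`i ∉ S` and `j ∈ S`. -/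
def IsIrreducible {n : ℕ} (A : Matrix (Fin n) (Fin n) ℝ) : Prop :=
  ∀ S : Set (Fin n), S.Nonempty → S ≠ Set.univ → ∃ i j, i ∉ S ∧ j ∈ S ∧ A i j ≠ 0

/-- `A` is lower Hessenberg: all entries above the first superdiagonal vanish. -/
def IsLowerHessenberg {n : ℕ} (A : Matrix (Fin n) (Fin n) ℝ) : Prop :=
  ∀ i j : Fin n, i.val + 1 < j.val → A i j = 0

/-- The lower triangular part of `A`, diagonal included. -/
def tril {n : ℕ} (A : Matrix (Fin n) (Fin n) ℝ) : Matrix (Fin n) (Fin n) ℝ :=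
  Matrix.of fun i j => if j ≤ i then A i j else 0

/-- The upper triangular part of `A`, diagonal included. -/
def triu {n : ℕ} (A : Matrix (Fin n) (Fin n) ℝ) : Matrix (Fin n) (Fin n) ℝ :=
  Matrix.of fun i j => if i ≤ j then A i j else 0

/-- The tridiagonal part of `A`. -/
def tridiag {n : ℕ} (A : Matrix (Fin n) (Fin n) ℝ) : Matrix (Fin n) (Fin n) ℝ :=
  Matrix.of fun i j => if i.val ≤ j.val + 1 ∧ j.val ≤ i.val + 1 then A i j else 0

/-- Stair matrix of first order: the tridiagonal part of `A` with the off-diagonal entries of the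
rows `1, 3, 5, …` deleted. Rows are counted from `1`, so row number `i.val + 1`. -/
def stairFirst {n : ℕ} (A : Matrix (Fin n) (Fin n) ℝ) : Matrix (Fin n) (Fin n) ℝ :=
  Matrix.of fun i j => if Odd (i.val + 1) ∧ i ≠ j then 0 else tridiag A i j

/-- Stair matrix of second order: the tridiagonal part of `A` with the off-diagonal entries of the
rows `2, 4, 6, …` (counted from `1`) deleted. -/
def stairSecond {n : ℕ} (A : Matrix (Fin n) (Fin n) ℝ) : Matrix (Fin n) (Fin n) ℝ :=
  Matrix.of fun i j => if Even (i.val + 1) ∧ i ≠ j then 0 else tridiag A i j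

/-- The leading principal submatrix of `A` of size one less than `A`. -/
def leading {m : ℕ} (A : Matrix (Fin (m + 1)) (Fin (m + 1)) ℝ) : Matrix (Fin m) (Fin m) ℝ :=
  A.submatrix Fin.castSucc Fin.castSucc

/-- The matrix `L = [I 0; eᵀ 1]`, where `e` is the vector of ones. -/
def elimL (m : ℕ) : Matrix (Fin (m + 1)) (Fin (m + 1)) ℝ :=
  Matrix.reindex finSumFinEquiv finSumFinEquiv
    (Matrix.fromBlocks (1 : Matrix (Fin m) (Fin m) ℝ) 0
      (Matrix.of fun (_ : Fin 1) (_ : Fin m) => (1 : ℝ)) (1 : Matrix (Fin 1) (Fin 1) ℝ))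

/-- The matrix `M' = L⁻¹ [K 0; 0ᵀ 1]` built from a square matrix `K` of size one less. -/
noncomputable def liftM {m : ℕ} (K : Matrix (Fin m) (Fin m) ℝ) :
    Matrix (Fin (m + 1)) (Fin (m + 1)) ℝ :=
  (elimL m)⁻¹ * Matrix.reindex finSumFinEquiv finSumFinEquiv
    (Matrix.fromBlocks K 0 0 (1 : Matrix (Fin 1) (Fin 1) ℝ))

/-- `M'` of the Jacobi-like splitting of `A`. -/
noncomputable def jacobiM {m : ℕ} (A : Matrix (Fin (m + 1)) (Fin (m + 1)) ℝ) :
    Matrix (Fin (m + 1)) (Fin (m + 1)) ℝ :=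
  liftM (Matrix.diagonal (leading A).diag)

/-- `M'` of the Gauss-Seidel-like splitting of `A`. -/
noncomputable def gaussSeidelM {m : ℕ} (A : Matrix (Fin (m + 1)) (Fin (m + 1)) ℝ) :
    Matrix (Fin (m + 1)) (Fin (m + 1)) ℝ :=
  liftM (tril (leading A))

/-- `M'` of the staircase-like splitting of `A` of first order. -/
noncomputable def stairFirstM {m : ℕ} (A : Matrix (Fin (m + 1)) (Fin (m + 1)) ℝ) :
    Matrix (Fin (m + 1)) (Fin (m + 1)) ℝ :=
  liftM (stairFirst (leading A))

/-- `M'` of the staircase-like splitting of `A` of second order. -/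
noncomputable def stairSecondM {m : ℕ} (A : Matrix (Fin (m + 1)) (Fin (m + 1)) ℝ) :
    Matrix (Fin (m + 1)) (Fin (m + 1)) ℝ :=
  liftM (stairSecond (leading A))

/-- `M'` of the anti-Gauss-Seidel-like splitting of `A`. -/
noncomputable def antiGaussSeidelM {m : ℕ} (A : Matrix (Fin (m + 1)) (Fin (m + 1)) ℝ) :
    Matrix (Fin (m + 1)) (Fin (m + 1)) ℝ :=
  liftM (triu (leading A))

/-- The iteration matrix `M⁻¹ N` of the splitting `A = M - N`, that is, with `N = M - A`. -/
noncomputable def iterMatrix {n : ℕ} (A M : Matrix (Fin n) (Fin n) ℝ) :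
    Matrix (Fin n) (Fin n) ℝ :=
  M⁻¹ * (M - A)

/-- The convergence factor `γ(P)`: the largest modulus of a complex eigenvalue of `P` other than
`1`. (The set is finite; the value is `0` if `1` is the only eigenvalue.) -/
noncomputable def convFactor {n : ℕ} (P : Matrix (Fin n) (Fin n) ℝ) : ℝ :=
  sSup {r : ℝ | ∃ z ∈ spectrum ℂ (P.map (algebraMap ℝ ℂ)), z ≠ 1 ∧ r = ‖z‖}

/-- `B` is a stochastic normalization of `A`: a positive diagonal scaling `B = D A E` of `A` of the
form `B = I - T` with a column stochastic matrix `T`. -/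
def IsNormalization {n : ℕ} (A B : Matrix (Fin n) (Fin n) ℝ) : Prop :=
  (∃ d e : Fin n → ℝ, (∀ i, 0 < d i) ∧ (∀ i, 0 < e i) ∧
    B = Matrix.diagonal d * A * Matrix.diagonal e) ∧
  ∃ T ∈ Matrix.colStochastic ℝ (Fin n), B = 1 - T

end HessenbergSplitting

open HessenbergSplitting

/-!
Let `B` be the leading principal submatrix of the normalized matrix `A = I - T`. As the columns of
`A` sum to zero, multiplication by `L` clears the last row of `A`, and the iteration matrix built
from `K` becomes block triangular with diagonal blocks `K⁻¹ (K - B)` and `1`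
(`det_smul_liftM_sub`). Irreducibility makes `B` a nonsingular M-matrix
(`isNonsingularMMatrix_leading`), so `γ` is the spectral radius of `K⁻¹ (K - B)`, and it remains to
compare these radii for five matrices `K`, each consisting of the entries of `B` at a set `q` of
positions that contains the diagonal.

If `v` is an eigenvector of `K⁻¹ (K - B)` for `z` and `r = |z|`, then `x = |v|` satisfies
`(r K - (K - B)) x ≤ 0`: entries inside `q` carry the factor `r ^ 1` and the others `r ^ 0`. A
diagonal scaling `x i ↦ r ^ a i * x i` shifts the exponent at `(i, j)` by `a i - a j`. Because
`r ≤ 1`, the inequality persists for a second set of positions whenever the shifted exponents of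
the first are at least those of the second, at all nonzero entries of `B`
(`IsNonsingularMMatrix.pencil_mulVec_scaled_nonpos`). Such a subeigenvector bounds the second
spectral radius from below by `r`, through Gelfand's formula
(`exists_mem_spectrum_of_smul_le_mulVec`). No scaling is needed to compare Jacobi with Gauss-Seidel.
For the other comparisons the Hessenberg form leaves a single superdiagonal, along which `a` can be
chosen to match the exponents exactly, as `i / 2` or `(i + 1) / 2`, and every position below the
diagonal then satisfies the required inequality.

The normalization comes from a positive left null vector of `A`, obtained by the usual
Perron–Frobenius argument (`exists_pos_vecMul_eq_smul`).
-/

namespace HessenbergSplitting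

open Matrix Finset

variable {ι : Type*} [Fintype ι] [DecidableEq ι]

/-! ### Lower bounds for the spectral radius of a nonnegative matrix -/

section Subinvariance
attribute [local instance] Matrix.linftyOpNormedRing Matrix.linftyOpNormedAlgebra

/-- A nonnegative matrix `P` with `r y ≤ P y` for some nonzero `y ≥ 0` has spectral radius at least
`r`: iterating gives `r ^ k y ≤ P ^ k y`, so `r ^ k ≤ ‖P ^ k‖`, and Gelfand's formula applies. -/
theorem exists_mem_spectrum_of_smul_le_mulVec {P : Matrix ι ι ℝ} (hP : ∀ i j, 0 ≤ P i j)
    {y : ι → ℝ} (hy : 0 ≤ y) (hy0 : y ≠ 0) {r : ℝ} (hr : 0 ≤ r) (h : r • y ≤ P *ᵥ y) :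
    ∃ z ∈ spectrum ℂ (P.map (algebraMap ℝ ℂ)), r ≤ ‖z‖ := by
  obtain ⟨i₀, hi₀⟩ : ∃ i, y i ≠ 0 := Function.ne_iff.mp hy0
  have hne : Nonempty ι := ⟨i₀⟩
  have hmono : ∀ u v : ι → ℝ, u ≤ v → P *ᵥ u ≤ P *ᵥ v := fun u v huv i =>
    Finset.sum_le_sum fun j _ => mul_le_mul_of_nonneg_left (huv j) (hP i j)
  have hpow : ∀ k : ℕ, r ^ k • y ≤ (P ^ k) *ᵥ y := by
    intro k
    induction k with
    | zero => simp
    | succ k ih =>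
      calc r ^ (k + 1) • y = r ^ k • (r • y) := by rw [pow_succ, mul_smul]
        _ ≤ r ^ k • (P *ᵥ y) := smul_le_smul_of_nonneg_left h (pow_nonneg hr k)
        _ = P *ᵥ (r ^ k • y) := by rw [mulVec_smul]
        _ ≤ P *ᵥ ((P ^ k) *ᵥ y) := hmono _ _ ih
        _ = (P ^ (k + 1)) *ᵥ y := by rw [mulVec_mulVec, pow_succ']
  have hpos : 0 < ‖y‖ := norm_pos_iff.mpr hy0
  set Q : Matrix ι ι ℂ := P.map (algebraMap ℝ ℂ) with hQ
  have hQk : ∀ k : ℕ, ‖Q ^ k‖ = ‖P ^ k‖ := by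
    intro k
    have : Q ^ k = (P ^ k).map (algebraMap ℝ ℂ) := by
      rw [hQ]; exact (map_pow (algebraMap ℝ ℂ).mapMatrix P k).symm
    rw [this]
    simp [Matrix.linfty_opNorm_def]
  have hbound : ∀ k : ℕ, r ^ k ≤ ‖Q ^ k‖ := by
    intro k
    have h1 : ‖r ^ k • y‖ ≤ ‖(P ^ k) *ᵥ y‖ := by
      refine (pi_norm_le_iff_of_nonneg (norm_nonneg _)).mpr fun i => ?_
      have h0 : 0 ≤ (r ^ k • y) i := mul_nonneg (pow_nonneg hr k) (hy i)
      calc ‖(r ^ k • y) i‖ = (r ^ k • y) i := Real.norm_of_nonneg h0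
        _ ≤ ((P ^ k) *ᵥ y) i := hpow k i
        _ ≤ ‖((P ^ k) *ᵥ y) i‖ := le_abs_self _
        _ ≤ _ := norm_le_pi_norm _ i
    have h2 := h1.trans (Matrix.linfty_opNorm_mulVec (P ^ k) y)
    rw [norm_smul, norm_pow, Real.norm_of_nonneg hr] at h2
    rw [hQk]
    exact le_of_mul_le_mul_right h2 hpos
  obtain ⟨z, hz, hzr⟩ := spectrum.exists_nnnorm_eq_spectralRadius (A := Matrix ι ι ℂ) Q
  refine ⟨z, hz, ?_⟩
  have hlim := spectrum.pow_nnnorm_pow_one_div_tendsto_nhds_spectralRadius (A := Matrix ι ι ℂ) Q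
  have hle : ENNReal.ofReal r ≤ spectralRadius ℂ Q := by
    refine ge_of_tendsto hlim ?_
    filter_upwards [Filter.eventually_gt_atTop 0] with k hk
    have hk' : (k : ℝ) ≠ 0 := by exact_mod_cast hk.ne'
    calc ENNReal.ofReal r = (ENNReal.ofReal r ^ (k : ℝ)) ^ (1 / k : ℝ) := by
          rw [← ENNReal.rpow_mul, mul_one_div_cancel hk', ENNReal.rpow_one]
      _ ≤ _ := by
          refine ENNReal.rpow_le_rpow ?_ (by positivity)
          rw [ENNReal.rpow_natCast, ← ENNReal.ofReal_pow hr]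
          exact ENNReal.coe_le_coe.mpr (Real.toNNReal_le_iff_le_coe.mpr (hbound k))
  rw [← hzr] at hle
  have := ENNReal.toReal_mono (by simp) hle
  simpa [ENNReal.toReal_ofReal hr] using this

end Subinvariance

/-- The eigenvalues of the iteration matrix of a splitting `B = K - (K - B)` are the roots of
`det (z K - (K - B))`. -/
theorem mem_spectrum_inv_mul_sub_iff {K B : Matrix ι ι ℝ} (hK : IsUnit K) (z : ℂ) :
    z ∈ spectrum ℂ ((K⁻¹ * (K - B)).map (algebraMap ℝ ℂ)) ↔
      (z • K.map (algebraMap ℝ ℂ) - (K - B).map (algebraMap ℝ ℂ)).det = 0 := by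
  have hdet := (isUnit_iff_isUnit_det _).mp hK
  have hdetC : (K.map (algebraMap ℝ ℂ)).det ≠ 0 := by
    have := (algebraMap ℝ ℂ).map_det K
    rw [RingHom.mapMatrix_apply] at this
    rw [← this]
    simpa using hdet.ne_zero
  have h1 : z • K.map (algebraMap ℝ ℂ) - (K - B).map (algebraMap ℝ ℂ) =
      K.map (algebraMap ℝ ℂ) *
        (algebraMap ℂ (Matrix ι ι ℂ) z - (K⁻¹ * (K - B)).map (algebraMap ℝ ℂ)) := by
    rw [mul_sub, ← Matrix.map_mul, mul_nonsing_inv_cancel_left _ _ hdet,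
      Algebra.algebraMap_eq_smul_one, mul_smul_comm, mul_one]
  rw [h1, det_mul, mul_eq_zero_iff_left hdetC, spectrum.mem_iff, isUnit_iff_isUnit_det,
    isUnit_iff_ne_zero, not_not]

/-! ### Splittings of nonsingular M-matrices given by a set of positions -/

/-- The matrix that agrees with `B` at the positions `(i, j)` with `q i j` and vanishes elsewhere.
All the splittings compared here are of the form `K = maskPart q B` with `q` reflexive, so that
`K` contains the diagonal of `B`. -/
def maskPart (q : ι → ι → Prop) [DecidableRel q] (B : Matrix ι ι ℝ) : Matrix ι ι ℝ :=
  Matrix.of fun i j => if q i j then B i j else 0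

/-- The matrix `r K - (K - B)` with `K = maskPart q B`: the entries of `B` inside `q` are multiplied
by `r`, the others are kept. For invertible `K` it is singular exactly when `r` is an eigenvalue of
the iteration matrix `K⁻¹ (K - B)`. -/
def pencil (q : ι → ι → Prop) [DecidableRel q] (B : Matrix ι ι ℝ) (r : ℝ) : Matrix ι ι ℝ :=
  Matrix.of fun i j => (if q i j then r else 1) * B i j

/-- `B` is a nonsingular M-matrix, encoded by the sign pattern of its off-diagonal entries and the
condition that `x ≥ 0` and `B x ≤ 0` force `x = 0`. This condition is the form in which
nonsingularity is used below. It also gives `B⁻¹ ≥ 0`, since it applies to the negative part of any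
`u` with `B u ≥ 0`. -/
structure IsNonsingularMMatrix (B : Matrix ι ι ℝ) : Prop where
  nonpos_of_ne : ∀ i j, i ≠ j → B i j ≤ 0
  eq_zero_of_mulVec_nonpos : ∀ x : ι → ℝ, 0 ≤ x → B *ᵥ x ≤ 0 → x = 0

namespace IsNonsingularMMatrix

variable {B : Matrix ι ι ℝ}

theorem diag_nonneg (hB : IsNonsingularMMatrix B) (i : ι) : 0 ≤ B i i := by
  by_contra hneg
  have h := hB.eq_zero_of_mulVec_nonpos (Pi.single i 1) (Pi.single_nonneg.mpr zero_le_one) ?_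
  · simpa using congrFun h i
  · intro k
    rw [mulVec_single_one, col_apply, Pi.zero_apply]
    by_cases hk : k = i
    · subst hk; exact (not_le.mp hneg).le
    · exact hB.nonpos_of_ne k i hk

variable {q : ι → ι → Prop} [DecidableRel q]

/-- Each `maskPart q B` with `q` reflexive is monotone. The negative part `x` of `u` satisfies
`B x ≤ 0`, because `B` has fewer zero off-diagonal entries than `maskPart q B`, all nonpositive. -/
theorem nonneg_of_maskPart_mulVec_nonneg (hB : IsNonsingularMMatrix B) (hq : ∀ i, q i i)
    {u : ι → ℝ} (hu : 0 ≤ maskPart q B *ᵥ u) : 0 ≤ u := by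
  have hx := hB.eq_zero_of_mulVec_nonpos (fun i => max (-u i) 0) (fun i => le_max_right _ _) ?_
  · intro i
    have := congrFun hx i
    simp only [Pi.zero_apply, max_eq_right_iff] at this
    simpa using this
  intro i
  rcases le_or_gt 0 (u i) with hi | hi
  · refine Finset.sum_nonpos fun j _ => ?_
    by_cases hij : i = j
    · subst hij; simp [max_eq_right (neg_nonpos.mpr hi)]
    · exact mul_nonpos_of_nonpos_of_nonneg (hB.nonpos_of_ne i j hij) (le_max_right _ _)
  · have h1 : (B *ᵥ fun i => max (-u i) 0) i ≤ -(maskPart q B *ᵥ u) i := by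
      simp only [mulVec, dotProduct, maskPart, of_apply]
      rw [← Finset.sum_neg_distrib]
      refine Finset.sum_le_sum fun j _ => ?_
      by_cases hij : i = j
      · subst hij; simp [hq, max_eq_left (neg_nonneg.mpr hi.le)]
      · have hb := hB.nonpos_of_ne i j hij
        split_ifs
        · nlinarith [le_max_left (-u j) 0]
        · nlinarith [le_max_right (-u j) 0]
    have := hu i
    simp only [Pi.zero_apply] at this ⊢
    linarith

theorem isUnit_maskPart (hB : IsNonsingularMMatrix B) (hq : ∀ i, q i i) :
    IsUnit (maskPart q B) := by
  rw [← mulVec_injective_iff_isUnit]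
  refine (injective_iff_map_eq_zero (maskPart q B).mulVecLin).mpr fun u hu => ?_
  rw [mulVecLin_apply] at hu
  refine le_antisymm ?_ (hB.nonneg_of_maskPart_mulVec_nonneg hq hu.ge)
  refine neg_nonneg.mp (hB.nonneg_of_maskPart_mulVec_nonneg hq ?_)
  rw [mulVec_neg, hu, neg_zero]

theorem maskPart_inv_mulVec_nonneg (hB : IsNonsingularMMatrix B) (hq : ∀ i, q i i)
    {w : ι → ℝ} (hw : 0 ≤ w) : 0 ≤ (maskPart q B)⁻¹ *ᵥ w := by
  apply hB.nonneg_of_maskPart_mulVec_nonneg hq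
  rwa [mulVec_mulVec, mul_nonsing_inv _ ((isUnit_iff_isUnit_det _).mp (hB.isUnit_maskPart hq)),
    one_mulVec]

omit [DecidableEq ι] in
theorem maskPart_sub_nonneg (hB : IsNonsingularMMatrix B) (hq : ∀ i, q i i) (i j : ι) :
    0 ≤ (maskPart q B - B) i j := by
  simp only [maskPart, Matrix.sub_apply, of_apply]
  split_ifs with h
  · simp
  · have : i ≠ j := fun hij => h (hij ▸ hq i)
    simpa using hB.nonpos_of_ne i j this

omit [DecidableEq ι] in
/-- For `r > 1` the pencil is entrywise at least `r B`, with equality on the diagonal, so that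
`B x ≤ 0` and hence `x = 0`. -/
theorem le_one_of_pencil_mulVec_nonpos (hB : IsNonsingularMMatrix B) (hq : ∀ i, q i i) {r : ℝ}
    {x : ι → ℝ} (hx : 0 ≤ x) (hx0 : x ≠ 0) (h : pencil q B r *ᵥ x ≤ 0) : r ≤ 1 := by
  by_contra! hr
  refine hx0 (hB.eq_zero_of_mulVec_nonpos x hx fun i => ?_)
  have h1 : r * (B *ᵥ x) i ≤ (pencil q B r *ᵥ x) i := by
    simp only [mulVec, dotProduct, pencil, of_apply]
    rw [Finset.mul_sum]
    refine Finset.sum_le_sum fun j _ => ?_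
    rw [← mul_assoc]
    refine mul_le_mul_of_nonneg_right ?_ (hx j)
    split_ifs with hqij
    · exact le_rfl
    · have : i ≠ j := fun hij => hqij (hij ▸ hq i)
      exact mul_le_mul_of_nonpos_right hr.le (hB.nonpos_of_ne i j this)
  have h2 := h i
  simp only [Pi.zero_apply] at h2 ⊢
  nlinarith

/-- Since `K = maskPart q B` has a nonnegative inverse, `(r K - (K - B)) y ≤ 0` means
`r y ≤ K⁻¹ (K - B) y`, so the iteration matrix has an eigenvalue of modulus at least `r`. -/
theorem exists_mem_spectrum_of_pencil_mulVec_nonpos (hB : IsNonsingularMMatrix B)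
    (hq : ∀ i, q i i) {r : ℝ} (hr : 0 ≤ r) {y : ι → ℝ} (hy : 0 ≤ y) (hy0 : y ≠ 0)
    (h : pencil q B r *ᵥ y ≤ 0) :
    ∃ z ∈ spectrum ℂ (((maskPart q B)⁻¹ * (maskPart q B - B)).map (algebraMap ℝ ℂ)), r ≤ ‖z‖ := by
  have hdet := (isUnit_iff_isUnit_det _).mp (hB.isUnit_maskPart hq)
  refine exists_mem_spectrum_of_smul_le_mulVec (fun i j => ?_) hy hy0 hr ?_
  · exact hB.maskPart_inv_mulVec_nonneg hq (w := fun k => (maskPart q B - B) k j)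
      (fun k => hB.maskPart_sub_nonneg hq k j) i
  · have hp : pencil q B r = r • maskPart q B - (maskPart q B - B) := by
      ext i j
      simp only [pencil, maskPart, of_apply, Matrix.sub_apply, Matrix.smul_apply, smul_eq_mul]
      split_ifs <;> ring
    have h1 := hB.maskPart_inv_mulVec_nonneg hq (w := -(pencil q B r *ᵥ y)) (neg_nonneg.mpr h)
    rw [hp, sub_mulVec, neg_sub, mulVec_sub, mulVec_mulVec, mulVec_mulVec,
      mul_smul_comm, nonsing_inv_mul _ hdet, smul_mulVec, one_mulVec] at h1
    exact sub_nonneg.mp h1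

/-- The triangle inequality carries a complex eigenvector `v` with eigenvalue `z` to the
subeigenvector `|v|` with `|z|`. -/
theorem pencil_norm_mulVec_nonpos (hB : IsNonsingularMMatrix B) (hq : ∀ i, q i i) {z : ℂ}
    {v : ι → ℂ} (h : ∀ i, ∑ j, (if q i j then z else 1) * (B i j : ℂ) * v j = 0) :
    pencil q B ‖z‖ *ᵥ (fun i => ‖v i‖) ≤ 0 := by
  intro i
  have h1 := h i
  rw [← Finset.add_sum_erase _ _ (Finset.mem_univ i), if_pos (hq i)] at h1
  simp only [mulVec, dotProduct, pencil, of_apply, Pi.zero_apply]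
  rw [← Finset.add_sum_erase _ _ (Finset.mem_univ i), if_pos (hq i)]
  have h2 : ‖z * (B i i : ℂ) * v i‖ ≤
      ∑ j ∈ Finset.univ.erase i, -((if q i j then ‖z‖ else 1) * B i j * ‖v j‖) := by
    rw [eq_neg_of_add_eq_zero_left h1, norm_neg]
    refine (norm_sum_le _ _).trans (Finset.sum_le_sum fun j hj => le_of_eq ?_)
    have hb := hB.nonpos_of_ne i j (Finset.ne_of_mem_erase hj).symm
    rw [norm_mul, norm_mul, Complex.norm_real, Real.norm_of_nonpos hb]
    split_ifs <;> simp
  rw [norm_mul, norm_mul, Complex.norm_real, Real.norm_of_nonneg (hB.diag_nonneg i),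
    Finset.sum_neg_distrib] at h2
  linarith

/-- Transfer of a subeigenvector from one splitting to another by a diagonal scaling. Entry `(i, j)`
of the pencil of `qₖ` carries the factor `r` to the power `1` or `0`, according as `qₖ i j` holds or
not. Conjugation by `diagonal (r ^ a i)` adds `a i - a j` to this exponent for `q₁`, and the
hypothesis says that the result is at least the exponent for `q₂`. As `r ≤ 1` and the off-diagonal
entries are nonpositive, the inequality survives. -/
theorem pencil_mulVec_scaled_nonpos (hB : IsNonsingularMMatrix B)
    {q₁ q₂ : ι → ι → Prop} [DecidableRel q₁] [DecidableRel q₂] (hq₁ : ∀ i, q₁ i i)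
    (hq₂ : ∀ i, q₂ i i) (a : ι → ℕ)
    (ha : ∀ i j, i ≠ j → B i j ≠ 0 →
      (if q₂ i j then 1 else 0) + a j ≤ (if q₁ i j then 1 else 0) + a i)
    {r : ℝ} (hr0 : 0 ≤ r) (hr1 : r ≤ 1) {x : ι → ℝ} (hx : 0 ≤ x)
    (h : pencil q₁ B r *ᵥ x ≤ 0) : pencil q₂ B r *ᵥ (fun i => r ^ a i * x i) ≤ 0 := by
  intro i
  have key : (pencil q₂ B r *ᵥ fun i => r ^ a i * x i) i ≤ r ^ a i * (pencil q₁ B r *ᵥ x) i := by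
    simp only [mulVec, dotProduct, pencil, of_apply]
    rw [Finset.mul_sum]
    refine Finset.sum_le_sum fun j _ => ?_
    by_cases hij : i = j
    · subst hij
      rw [if_pos (hq₁ i), if_pos (hq₂ i)]
      exact le_of_eq (by ring)
    have hpow : ∀ (p : Prop) [Decidable p], (if p then r else 1) = r ^ (if p then 1 else 0) := by
      intro p _; split_ifs <;> simp
    rw [hpow, hpow]
    have hb := hB.nonpos_of_ne i j hij
    by_cases hb0 : B i j = 0
    · simp [hb0]
    have hle : r ^ ((if q₁ i j then 1 else 0) + a i) ≤ r ^ ((if q₂ i j then 1 else 0) + a j) :=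
      pow_le_pow_of_le_one hr0 hr1 (ha i j hij hb0)
    rw [pow_add, pow_add] at hle
    nlinarith [mul_nonneg (sub_nonneg.mpr hle) (mul_nonneg (neg_nonneg.mpr hb) (hx j))]
  exact key.trans (mul_nonpos_of_nonneg_of_nonpos (pow_nonneg hr0 _) (h i))

/-- Comparison of spectral radii: if a potential `a` relates the exponents of the two splittings, the
iteration matrix of `q₁` has spectral radius at most that of the iteration matrix of `q₂`. -/
theorem exists_mem_spectrum_norm_le (hB : IsNonsingularMMatrix B)
    {q₁ q₂ : ι → ι → Prop} [DecidableRel q₁] [DecidableRel q₂] (hq₁ : ∀ i, q₁ i i)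
    (hq₂ : ∀ i, q₂ i i) (a : ι → ℕ)
    (ha : ∀ i j, i ≠ j → B i j ≠ 0 →
      (if q₂ i j then 1 else 0) + a j ≤ (if q₁ i j then 1 else 0) + a i)
    {z : ℂ}
    (hz : z ∈ spectrum ℂ (((maskPart q₁ B)⁻¹ * (maskPart q₁ B - B)).map (algebraMap ℝ ℂ))) :
    ∃ w ∈ spectrum ℂ (((maskPart q₂ B)⁻¹ * (maskPart q₂ B - B)).map (algebraMap ℝ ℂ)),
      ‖z‖ ≤ ‖w‖ := by
  rw [mem_spectrum_inv_mul_sub_iff (hB.isUnit_maskPart hq₁), ← exists_mulVec_eq_zero_iff] at hz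
  obtain ⟨v, hv0, hv⟩ := hz
  have hx0 : (fun i => ‖v i‖) ≠ 0 := fun h => hv0 (funext fun i => norm_eq_zero.mp (congrFun h i))
  have hx : (0 : ι → ℝ) ≤ fun i => ‖v i‖ := fun i => norm_nonneg _
  have hsub : pencil q₁ B ‖z‖ *ᵥ (fun i => ‖v i‖) ≤ 0 := by
    refine hB.pencil_norm_mulVec_nonpos hq₁ fun i => ?_
    refine Eq.trans ?_ (congrFun hv i)
    refine Finset.sum_congr rfl fun j _ => ?_
    simp only [maskPart, Matrix.sub_apply, Matrix.smul_apply, map_apply, of_apply, smul_eq_mul]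
    split_ifs <;> simp
  have hr1 := hB.le_one_of_pencil_mulVec_nonpos hq₁ hx hx0 hsub
  obtain ⟨i, hi⟩ : ∃ i, v i ≠ 0 := Function.ne_iff.mp hv0
  -- For `z = 0` the scaled vector may vanish, but then every eigenvalue will do.
  rcases eq_or_ne z 0 with rfl | hz0
  · have : Nonempty ι := ⟨i⟩
    obtain ⟨w, hw⟩ := spectrum.nonempty_of_isAlgClosed_of_finiteDimensional ℂ
      (((maskPart q₂ B)⁻¹ * (maskPart q₂ B - B)).map (algebraMap ℝ ℂ))
    exact ⟨w, hw, by simp⟩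
  · refine hB.exists_mem_spectrum_of_pencil_mulVec_nonpos hq₂ (norm_nonneg z) ?_ ?_
      (hB.pencil_mulVec_scaled_nonpos hq₁ hq₂ a ha (norm_nonneg z) hr1 hx hsub)
    · exact fun i => mul_nonneg (pow_nonneg (norm_nonneg z) _) (norm_nonneg _)
    · intro h
      have := congrFun h i
      simp [hz0, hi] at this

theorem det_ne_zero (hB : IsNonsingularMMatrix B) : B.det ≠ 0 := by
  have h := hB.isUnit_maskPart (q := fun _ _ => True) fun _ => trivial
  have : maskPart (fun _ _ => True) B = B := by ext; simp [maskPart]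
  rw [this] at h
  exact ((isUnit_iff_isUnit_det _).mp h).ne_zero

end IsNonsingularMMatrix

/-! ### Reduction to the leading principal submatrix -/

section Lift

variable {m : ℕ}

/-- Left multiplication by `L` replaces the last row by the column sums. -/
theorem elimL_mul (X : Matrix (Fin (m + 1)) (Fin (m + 1)) ℝ) :
    elimL m * X = Matrix.of fun i j => Fin.lastCases (∑ k, X k j) (fun i' => X i'.castSucc j) i := by
  have hc : ∀ i : Fin m, finSumFinEquiv.symm i.castSucc = (Sum.inl i : Fin m ⊕ Fin 1) :=
    finSumFinEquiv_symm_apply_castAdd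
  have hl : finSumFinEquiv.symm (Fin.last m) = (Sum.inr 0 : Fin m ⊕ Fin 1) :=
    finSumFinEquiv_symm_last
  ext i j
  refine Fin.lastCases ?_ (fun i => ?_) i
  · simp [elimL, mul_apply, Fin.sum_univ_castSucc, hc, hl]
  · simp [elimL, mul_apply, Fin.sum_univ_castSucc, hc, hl, one_apply]

theorem det_elimL : (elimL m).det = 1 := by
  simp [elimL]

theorem elimL_mul_liftM (K : Matrix (Fin m) (Fin m) ℝ) :
    elimL m * liftM K = reindex finSumFinEquiv finSumFinEquiv
      (fromBlocks K 0 0 (1 : Matrix (Fin 1) (Fin 1) ℝ)) :=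
  mul_nonsing_inv_cancel_left _ _ (by simp [det_elimL])

theorem isUnit_liftM {K : Matrix (Fin m) (Fin m) ℝ} (hK : IsUnit K) : IsUnit (liftM K) := by
  rw [isUnit_iff_isUnit_det] at hK ⊢
  have h := congrArg det (elimL_mul_liftM K)
  rw [det_mul, det_elimL, one_mul, det_reindex_self, det_fromBlocks_zero₂₁, det_one, mul_one] at h
  rwa [h]

theorem elimL_mul_eq_fromBlocks {A : Matrix (Fin (m + 1)) (Fin (m + 1)) ℝ}
    (hA : ∀ j, ∑ i, A i j = 0) :
    elimL m * A = reindex finSumFinEquiv finSumFinEquiv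
      (fromBlocks (leading A) (Matrix.of fun i (_ : Fin 1) => A i.castSucc (Fin.last m)) 0 0) := by
  have hc : ∀ i : Fin m, finSumFinEquiv.symm i.castSucc = (Sum.inl i : Fin m ⊕ Fin 1) :=
    finSumFinEquiv_symm_apply_castAdd
  have hl : finSumFinEquiv.symm (Fin.last m) = (Sum.inr 0 : Fin m ⊕ Fin 1) :=
    finSumFinEquiv_symm_last
  rw [elimL_mul]
  ext i j
  refine Fin.lastCases ?_ (fun i => ?_) i
  · refine Fin.lastCases ?_ (fun j => ?_) j <;> simp [hc, hl, hA]
  · refine Fin.lastCases ?_ (fun j => ?_) j <;> simp [hc, hl, leading]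

/-- The factor `z - 1` is the eigenvalue `1` that all these iteration matrices share. The other
factor is the pencil of the splitting of the leading principal submatrix. -/
theorem det_smul_liftM_sub {A : Matrix (Fin (m + 1)) (Fin (m + 1)) ℝ}
    (hA : ∀ j, ∑ i, A i j = 0) (K : Matrix (Fin m) (Fin m) ℝ) (z : ℂ) :
    (z • (liftM K).map (algebraMap ℝ ℂ) - (liftM K - A).map (algebraMap ℝ ℂ)).det =
      (z • K.map (algebraMap ℝ ℂ) - (K - leading A).map (algebraMap ℝ ℂ)).det * (z - 1) := by
  have hdetL : ((elimL m).map (algebraMap ℝ ℂ)).det = 1 := by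
    have := (algebraMap ℝ ℂ).map_det (elimL m)
    rw [RingHom.mapMatrix_apply] at this
    rw [← this, det_elimL, map_one]
  have hL : (elimL m).map (algebraMap ℝ ℂ) *
      (z • (liftM K).map (algebraMap ℝ ℂ) - (liftM K - A).map (algebraMap ℝ ℂ)) =
      reindex finSumFinEquiv finSumFinEquiv
        (fromBlocks (z • K.map (algebraMap ℝ ℂ) - (K - leading A).map (algebraMap ℝ ℂ))
          (Matrix.of fun i (_ : Fin 1) => (A i.castSucc (Fin.last m) : ℂ)) 0
          (Matrix.of fun (_ _ : Fin 1) => z - 1)) := by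
    rw [mul_sub, mul_smul_comm, ← Matrix.map_mul, ← Matrix.map_mul, mul_sub, elimL_mul_liftM,
      elimL_mul_eq_fromBlocks hA]
    ext i j
    simp only [reindex_apply, Matrix.sub_apply, Matrix.smul_apply, map_apply, submatrix_apply]
    rcases finSumFinEquiv.symm i with i | i <;> rcases finSumFinEquiv.symm j with j | j <;>
      simp [Fin.fin_one_eq_zero]
  have h := congrArg det hL
  rwa [det_mul, hdetL, one_mul, det_reindex_self, det_fromBlocks_zero₂₁, det_fin_one,
    of_apply] at h

/-- Dropping the eigenvalue `1` leaves exactly the spectrum of the iteration matrix of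
`leading A`, which does not contain `1` since `leading A` is nonsingular. -/
theorem mem_spectrum_iterMatrix_liftM_iff {A : Matrix (Fin (m + 1)) (Fin (m + 1)) ℝ}
    (hA : ∀ j, ∑ i, A i j = 0) (hB : (leading A).det ≠ 0) {K : Matrix (Fin m) (Fin m) ℝ}
    (hK : IsUnit K) (z : ℂ) :
    z ∈ spectrum ℂ ((iterMatrix A (liftM K)).map (algebraMap ℝ ℂ)) ∧ z ≠ 1 ↔
      z ∈ spectrum ℂ ((iterMatrix (leading A) K).map (algebraMap ℝ ℂ)) := by
  rw [iterMatrix, iterMatrix, mem_spectrum_inv_mul_sub_iff (isUnit_liftM hK),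
    mem_spectrum_inv_mul_sub_iff hK, det_smul_liftM_sub hA, mul_eq_zero, sub_eq_zero]
  constructor
  · rintro ⟨h | h, h1⟩
    · exact h
    · exact absurd h h1
  · refine fun h => ⟨Or.inl h, ?_⟩
    rintro rfl
    refine hB ?_
    rw [one_smul, ← Matrix.map_sub _ (map_sub _), sub_sub_cancel, ← RingHom.mapMatrix_apply,
      ← RingHom.map_det] at h
    simpa using h

theorem convFactor_iterMatrix_liftM_le {A : Matrix (Fin (m + 1)) (Fin (m + 1)) ℝ}
    (hA : ∀ j, ∑ i, A i j = 0) (hB : IsNonsingularMMatrix (leading A))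
    {q₁ q₂ : Fin m → Fin m → Prop} [DecidableRel q₁] [DecidableRel q₂] (hq₁ : ∀ i, q₁ i i)
    (hq₂ : ∀ i, q₂ i i) (a : Fin m → ℕ)
    (ha : ∀ i j, i ≠ j → leading A i j ≠ 0 →
      (if q₂ i j then 1 else 0) + a j ≤ (if q₁ i j then 1 else 0) + a i) :
    convFactor (iterMatrix A (liftM (maskPart q₁ (leading A)))) ≤
      convFactor (iterMatrix A (liftM (maskPart q₂ (leading A)))) := by
  have hbdd : BddAbove {r : ℝ | ∃ z ∈ spectrum ℂ
      ((iterMatrix A (liftM (maskPart q₂ (leading A)))).map (algebraMap ℝ ℂ)), z ≠ 1 ∧ r = ‖z‖} := by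
    refine ((Matrix.finite_spectrum ((iterMatrix A (liftM (maskPart q₂ (leading A)))).map
      (algebraMap ℝ ℂ))).image norm).subset ?_ |>.bddAbove
    rintro r ⟨z, hz, -, rfl⟩
    exact ⟨z, hz, rfl⟩
  refine Real.sSup_le ?_ (Real.sSup_nonneg ?_)
  · rintro r ⟨z, hz, hz1, rfl⟩
    obtain ⟨w, hw, hzw⟩ := hB.exists_mem_spectrum_norm_le hq₁ hq₂ a ha
      ((mem_spectrum_iterMatrix_liftM_iff hA hB.det_ne_zero (hB.isUnit_maskPart hq₁) z).mp
        ⟨hz, hz1⟩)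
    obtain ⟨hw, hw1⟩ :=
      (mem_spectrum_iterMatrix_liftM_iff hA hB.det_ne_zero (hB.isUnit_maskPart hq₂) w).mpr hw
    exact hzw.trans (le_csSup hbdd ⟨w, hw, hw1, rfl⟩)
  · rintro r ⟨z, -, -, rfl⟩
    exact norm_nonneg z

end Lift

/-! ### Stochastic normalization of irreducible singular M-matrices -/

section Normalization

/-- Multiplication by `1 + C` never shrinks the support of `w`, and by irreducibility it enlarges it
until it is everything. -/
theorem exists_vecMul_one_add_pow_pos {n : ℕ} {C : Matrix (Fin n) (Fin n) ℝ}
    (hC : ∀ i j, 0 ≤ C i j) (hirr : IsIrreducible C) {w : Fin n → ℝ} (hw : 0 ≤ w) (hw0 : w ≠ 0) :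
    ∃ k : ℕ, ∀ j, 0 < (w ᵥ* (1 + C) ^ k) j := by
  induction hN : #{j | w j = 0} using Nat.strong_induction_on generalizing w with
  | _ N ih =>
  have hstep : ∀ j, w j ≤ (w ᵥ* (1 + C)) j := fun j => by
    rw [vecMul_add, vecMul_one, Pi.add_apply]
    have : 0 ≤ ∑ i, w i * C i j := Finset.sum_nonneg fun i _ => mul_nonneg (hw i) (hC i j)
    exact le_add_of_nonneg_right this
  by_cases hz : ∃ j, w j = 0
  · obtain ⟨i, j, hi, hj, hij⟩ := hirr {j | w j = 0} hz (fun h => hw0 (funext fun j =>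
      (Set.eq_univ_iff_forall.mp h j)))
    have hwi : 0 < w i := lt_of_le_of_ne (hw i) (Ne.symm hi)
    have hjpos : 0 < (w ᵥ* (1 + C)) j := by
      rw [vecMul_add, vecMul_one, Pi.add_apply]
      refine add_pos_of_nonneg_of_pos (hw j) ?_
      exact Finset.sum_pos' (fun k _ => mul_nonneg (hw k) (hC k j))
        ⟨i, Finset.mem_univ i, mul_pos hwi (lt_of_le_of_ne (hC i j) (Ne.symm hij))⟩
    have hcard : #{j | (w ᵥ* (1 + C)) j = 0} < N := by
      rw [← hN]
      refine Finset.card_lt_card ⟨fun k hk => ?_, fun h => ?_⟩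
      · simp only [Finset.mem_filter, Finset.mem_univ, true_and] at hk ⊢
        exact le_antisymm (hk ▸ hstep k) (hw k)
      · have := h (Finset.mem_filter.mpr ⟨Finset.mem_univ j, hj⟩)
        simp only [Finset.mem_filter, Finset.mem_univ, true_and] at this
        exact hjpos.ne' this
    obtain ⟨k, hk⟩ := ih _ hcard (fun j => (hw j).trans (hstep j))
      (fun h => hjpos.ne' (congrFun h j)) rfl
    exact ⟨k + 1, fun j => by rw [pow_succ', ← vecMul_vecMul]; exact hk j⟩
  · push Not at hz
    exact ⟨0, fun j => by simpa using lt_of_le_of_ne (hw j) (hz j).symm⟩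

/-- The part of the Perron–Frobenius theorem behind normalization: if the eigenvalue `s` of an
irreducible `C ≥ 0` bounds its spectral radius, it has a positive left eigenvector. The vector of
moduli `x` of a left null vector of `s - C` satisfies `s x ≤ x C`. If this were not an equality,
multiplication by a power of `1 + C` would make it strict in all entries, and `C` would have an
eigenvalue of modulus above `s`. -/
theorem exists_pos_vecMul_eq_smul {n : ℕ} {C : Matrix (Fin n) (Fin n) ℝ} {s : ℝ} (hs : 0 < s)
    (hC : ∀ i j, 0 ≤ C i j) (hirr : IsIrreducible C)
    (hρ : spectralRadius ℂ (C.map (algebraMap ℝ ℂ)) ≤ ENNReal.ofReal s)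
    (hsing : (s • (1 : Matrix (Fin n) (Fin n) ℝ) - C).det = 0) :
    ∃ d : Fin n → ℝ, (∀ i, 0 < d i) ∧ d ᵥ* C = s • d := by
  obtain ⟨v, hv0, hv⟩ := exists_vecMul_eq_zero_iff.mpr hsing
  have hv' : v ᵥ* C = s • v := by
    rw [vecMul_sub, vecMul_smul, vecMul_one, sub_eq_zero] at hv
    exact hv.symm
  set x : Fin n → ℝ := fun i => |v i| with hx_def
  have hx : 0 ≤ x := fun i => abs_nonneg _
  have hx0 : x ≠ 0 := fun h => hv0 (funext fun i => abs_eq_zero.mp (congrFun h i))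
  set u : Fin n → ℝ := x ᵥ* C - s • x with hu_def
  have hu : 0 ≤ u := by
    refine sub_nonneg.mpr fun j => ?_
    calc (s • x) j = |(s • v) j| := by simp [hx_def, abs_mul, abs_of_pos hs]
      _ = |∑ i, v i * C i j| := by rw [← hv']; rfl
      _ ≤ ∑ i, |v i * C i j| := Finset.abs_sum_le_sum_abs _ _
      _ = (x ᵥ* C) j := Finset.sum_congr rfl fun i _ => by
          rw [abs_mul, abs_of_nonneg (hC i j)]
  have hu0 : u = 0 := by
    by_contra hne
    obtain ⟨k, hk⟩ := exists_vecMul_one_add_pow_pos hC hirr hu hne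
    set y : Fin n → ℝ := x ᵥ* (1 + C) ^ k with hy_def
    have hcomm : Commute C ((1 + C) ^ k) := ((Commute.one_right C).add_right rfl).pow_right k
    have huy : u ᵥ* (1 + C) ^ k = y ᵥ* C - s • y := by
      rw [hu_def, sub_vecMul, vecMul_vecMul, hcomm.eq, ← vecMul_vecMul, smul_vecMul]
    have hCk : ∀ l : ℕ, ∀ i j, 0 ≤ ((1 + C) ^ l) i j := by
      intro l
      induction l with
      | zero => intro i j; rw [pow_zero, one_apply]; split_ifs <;> simp
      | succ l ih =>
        intro i j
        rw [pow_succ, mul_apply]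
        refine Finset.sum_nonneg fun t _ => mul_nonneg (ih i t) (add_nonneg ?_ (hC t j))
        rw [one_apply]; split_ifs <;> simp
    have hy : 0 ≤ y := fun j =>
      show 0 ≤ ∑ i, x i * ((1 + C) ^ k) i j from
        Finset.sum_nonneg fun i _ => mul_nonneg (hx i) (hCk k i j)
    have hy0 : y ≠ 0 := by
      intro h
      rw [huy, h] at hk
      obtain ⟨i, -⟩ := Function.ne_iff.mp hx0
      simpa using hk i
    have hlt : ∀ᶠ t in nhdsWithin s (Set.Ioi s), ∀ j, t * y j < (y ᵥ* C) j := by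
      refine Filter.eventually_all.mpr fun j => ?_
      have hc : ContinuousAt (fun t : ℝ => t * y j) s := by fun_prop
      refine (hc.eventually_lt_const ?_).filter_mono nhdsWithin_le_nhds
      have := hk j
      rw [huy] at this
      simpa using this
    obtain ⟨t, ht, hst⟩ := (hlt.and self_mem_nhdsWithin).exists
    have hst : s < t := hst
    obtain ⟨z, hz, htz⟩ := exists_mem_spectrum_of_smul_le_mulVec (P := Cᵀ) (fun i j => hC j i)
      hy hy0 (hs.le.trans hst.le) (fun j => by rw [mulVec_transpose]; exact (ht j).le)
    have hz' : z ∈ spectrum ℂ (C.map (algebraMap ℝ ℂ)) := by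
      rw [mem_spectrum_iff_isRoot_charpoly] at hz ⊢
      rwa [transpose_map, charpoly_transpose] at hz
    have h1 : (‖z‖₊ : ENNReal) ≤ ENNReal.ofReal s :=
      (le_iSup₂ (f := fun (z : ℂ) (_ : z ∈ spectrum ℂ (C.map (algebraMap ℝ ℂ))) =>
        (‖z‖₊ : ENNReal)) z hz').trans hρ
    have h2 := ENNReal.toReal_mono ENNReal.ofReal_ne_top h1
    rw [ENNReal.toReal_ofReal hs.le] at h2
    have h3 : ‖z‖ ≤ s := by simpa using h2
    linarith
  have hxC : x ᵥ* C = s • x := sub_eq_zero.mp hu0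
  refine ⟨x, ?_, hxC⟩
  obtain ⟨k, hk⟩ := exists_vecMul_one_add_pow_pos hC hirr hx hx0
  have hpow : ∀ l : ℕ, x ᵥ* (1 + C) ^ l = (1 + s) ^ l • x := by
    intro l
    induction l with
    | zero => simp
    | succ l ih =>
      rw [pow_succ, ← vecMul_vecMul, ih, smul_vecMul, vecMul_add, vecMul_one, hxC, pow_succ,
        mul_smul, add_smul, one_smul]
  intro i
  have := hk i
  rw [hpow] at this
  exact pos_of_mul_pos_right this (by positivity)

/-- A positive left null vector `d` of `A = s - C` gives the scaling `D = diagonal d`, which makes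
the column sums vanish. The choice `E = (s D)⁻¹` makes the diagonal of `D A E` at most `1`. -/
theorem exists_isNormalization {n : ℕ} {A : Matrix (Fin n) (Fin n) ℝ} (hM : IsMMatrix A)
    (hirr : IsIrreducible A) (hsing : A.det = 0) : ∃ A', IsNormalization A A' := by
  obtain ⟨s, C, hs, hC, hρ, rfl⟩ := hM
  have hoff : ∀ i j, i ≠ j → (s • (1 : Matrix (Fin n) (Fin n) ℝ) - C) i j = -C i j := by
    intro i j hij
    simp [one_apply_ne hij]
  have hirrC : IsIrreducible C := by
    intro S hS hS'
    obtain ⟨i, j, hi, hj, hij⟩ := hirr S hS hS'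
    refine ⟨i, j, hi, hj, ?_⟩
    rw [hoff i j (fun h => hi (h ▸ hj))] at hij
    exact neg_ne_zero.mp hij
  obtain ⟨d, hd, hdC⟩ := exists_pos_vecMul_eq_smul hs hC hirrC hρ hsing
  set A := s • (1 : Matrix (Fin n) (Fin n) ℝ) - C with hA
  have hdA : d ᵥ* A = 0 := by
    rw [hA, vecMul_sub, vecMul_smul, vecMul_one, hdC, sub_self]
  have hds : ∀ i, 0 < d i * s := fun i => mul_pos (hd i) hs
  refine ⟨diagonal d * A * diagonal fun i => (d i * s)⁻¹,
    ⟨d, _, hd, fun i => inv_pos.mpr (hds i), rfl⟩,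
    1 - diagonal d * A * diagonal fun i => (d i * s)⁻¹, ?_, (sub_sub_cancel _ _).symm⟩
  rw [mem_colStochastic]
  refine ⟨fun i j => ?_, ?_⟩
  · rw [Matrix.sub_apply, mul_diagonal, diagonal_mul]
    by_cases hij : i = j
    · subst hij
      rw [one_apply_eq, sub_nonneg, mul_inv_le_iff₀ (hds i), one_mul]
      refine mul_le_mul_of_nonneg_left ?_ (hd i).le
      simp [hA, hC]
    · rw [one_apply_ne hij, hoff i j hij, zero_sub, mul_neg, neg_mul, neg_neg]
      exact mul_nonneg (mul_nonneg (hd i).le (hC i j)) (inv_pos.mpr (hds j)).le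
  · have h1 : (1 : Fin n → ℝ) ᵥ* diagonal d = d := by
      ext i; simp [vecMul_diagonal]
    rw [vecMul_sub, vecMul_one, ← vecMul_vecMul, ← vecMul_vecMul, h1, hdA, zero_vecMul, sub_zero]

theorem IsNormalization.apply_ne_zero_iff {n : ℕ} {A A' : Matrix (Fin n) (Fin n) ℝ}
    (h : IsNormalization A A') (i j : Fin n) : A' i j ≠ 0 ↔ A i j ≠ 0 := by
  obtain ⟨⟨d, e, hd, he, rfl⟩, -⟩ := h
  simp [mul_diagonal, diagonal_mul, (hd i).ne', (he j).ne']

theorem IsNormalization.sum_eq_zero {n : ℕ} {A A' : Matrix (Fin n) (Fin n) ℝ}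
    (h : IsNormalization A A') (j : Fin n) : ∑ i, A' i j = 0 := by
  obtain ⟨-, T, hT, rfl⟩ := h
  have := congrFun (mem_colStochastic.mp hT).2 j
  simp only [vecMul, dotProduct, Pi.one_apply, one_mul] at this
  simp [Finset.sum_sub_distrib, this, one_apply]

theorem IsNormalization.nonpos_of_ne {n : ℕ} {A A' : Matrix (Fin n) (Fin n) ℝ}
    (h : IsNormalization A A') {i j : Fin n} (hij : i ≠ j) : A' i j ≤ 0 := by
  obtain ⟨-, T, hT, rfl⟩ := h
  simpa [one_apply_ne hij] using (mem_colStochastic.mp hT).1 i j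

/-- Suppose `x ≥ 0` and `B x ≤ 0` for `B = leading A`. The column sums of `B` are nonnegative, so
adding up the rows shows that `B x = 0` and that the last row of `A` vanishes on the support of `x`.
A nonempty support would then contradict the irreducibility of `A`. -/
theorem isNonsingularMMatrix_leading {m : ℕ} {A : Matrix (Fin (m + 1)) (Fin (m + 1)) ℝ}
    (hirr : IsIrreducible A) (hoff : ∀ i j, i ≠ j → A i j ≤ 0) (hsum : ∀ j, ∑ i, A i j = 0) :
    IsNonsingularMMatrix (leading A) := by
  refine ⟨fun i j hij => hoff _ _ (fun h => hij (Fin.castSucc_injective m h)), fun x hx hBx => ?_⟩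
  have hcol : ∀ j : Fin m, ∑ i, leading A i j = -A (Fin.last m) j.castSucc := fun j => by
    have := hsum j.castSucc
    rw [Fin.sum_univ_castSucc] at this
    exact eq_neg_of_add_eq_zero_left this
  have hlast : ∀ j : Fin m, A (Fin.last m) j.castSucc ≤ 0 := fun j =>
    hoff _ _ (Fin.castSucc_lt_last j).ne'
  have htotal : ∑ i, (leading A *ᵥ x) i = ∑ j, -A (Fin.last m) j.castSucc * x j := by
    simp only [mulVec, dotProduct]
    rw [Finset.sum_comm]
    exact Finset.sum_congr rfl fun j _ => by rw [← Finset.sum_mul, hcol]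
  have hnn : ∀ j ∈ Finset.univ, 0 ≤ -A (Fin.last m) j.castSucc * x j := fun j _ =>
    mul_nonneg (neg_nonneg.mpr (hlast j)) (hx j)
  have hzero : ∑ j, -A (Fin.last m) j.castSucc * x j = 0 :=
    le_antisymm (htotal ▸ Finset.sum_nonpos fun i _ => hBx i) (Finset.sum_nonneg hnn)
  have hlast0 := (Finset.sum_eq_zero_iff_of_nonneg hnn).mp hzero
  have hBx0 := (Finset.sum_eq_zero_iff_of_nonpos (fun i _ => hBx i)).mp (htotal.trans hzero)
  by_contra hx0
  obtain ⟨j₀, hj₀⟩ : ∃ j, x j ≠ 0 := Function.ne_iff.mp hx0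
  obtain ⟨i, j, hi, ⟨j, hj, rfl⟩, hij⟩ := hirr (Fin.castSucc '' {j | x j ≠ 0})
    ⟨_, j₀, hj₀, rfl⟩ (fun h => by
      obtain ⟨j, -, hj⟩ := h.ge (Set.mem_univ (Fin.last m))
      exact (Fin.castSucc_lt_last j).ne hj)
  have hj : x j ≠ 0 := hj
  refine hij ?_
  induction i using Fin.lastCases with
  | last => simpa [hj] using hlast0 j (Finset.mem_univ j)
  | cast i =>
    have hxi : x i = 0 := by
      by_contra h
      exact hi ⟨i, h, rfl⟩
    have hterm : ∀ k ∈ Finset.univ, leading A i k * x k ≤ 0 := fun k _ => by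
      by_cases hik : i = k
      · simp [← hik, hxi]
      · exact mul_nonpos_of_nonpos_of_nonneg
          (hoff _ _ (fun h => hik (Fin.castSucc_injective m h))) (hx k)
    have := (Finset.sum_eq_zero_iff_of_nonpos hterm).mp (hBx0 i (Finset.mem_univ i)) j
      (Finset.mem_univ j)
    exact (mul_eq_zero.mp this).resolve_right hj

end Normalization

/-! ### The five splittings as sets of positions -/

section Parts

variable {m : ℕ} (B : Matrix (Fin m) (Fin m) ℝ)

theorem diagonal_diag_eq_maskPart : diagonal B.diag = maskPart (fun i j => i = j) B := by
  ext i j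
  by_cases h : i = j
  · simp [maskPart, h]
  · simp [maskPart, h]

theorem tril_eq_maskPart : tril B = maskPart (fun i j => j ≤ i) B := rfl

theorem triu_eq_maskPart : triu B = maskPart (fun i j => i ≤ j) B := rfl

theorem stairFirst_eq_maskPart : stairFirst B = maskPart
    (fun i j => i = j ∨ Even (i.val + 1) ∧ i.val ≤ j.val + 1 ∧ j.val ≤ i.val + 1) B := by
  ext i j
  simp only [stairFirst, tridiag, maskPart, of_apply, ← Nat.not_even_iff_odd]
  by_cases h : i = j
  · simp [h]
  · by_cases h' : Even (i.val + 1) <;> simp [h, h']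

theorem stairSecond_eq_maskPart : stairSecond B = maskPart
    (fun i j => i = j ∨ Odd (i.val + 1) ∧ i.val ≤ j.val + 1 ∧ j.val ≤ i.val + 1) B := by
  ext i j
  simp only [stairSecond, tridiag, maskPart, of_apply, ← Nat.not_even_iff_odd]
  by_cases h : i = j
  · simp [h]
  · by_cases h' : Even (i.val + 1) <;> simp [h, h']

end Parts

end HessenbergSplitting

theorem theorem6 {m : ℕ} (A : Matrix (Fin (m + 1)) (Fin (m + 1)) ℝ)
    (hM : IsMMatrix A) (hirr : IsIrreducible A) (hsing : A.det = 0)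
    (hHess : IsLowerHessenberg A) :
    (∃ A', IsNormalization A A') ∧
    ∀ A', IsNormalization A A' →
      (IsUnit (jacobiM A') ∧ IsUnit (gaussSeidelM A') ∧ IsUnit (stairFirstM A') ∧
        IsUnit (stairSecondM A') ∧ IsUnit (antiGaussSeidelM A')) ∧
      (convFactor (iterMatrix A' (jacobiM A')) ≥ convFactor (iterMatrix A' (gaussSeidelM A')) ∧
        convFactor (iterMatrix A' (gaussSeidelM A')) ≥ convFactor (iterMatrix A' (stairFirstM A')) ∧
        convFactor (iterMatrix A' (stairFirstM A')) ≥
          convFactor (iterMatrix A' (antiGaussSeidelM A'))) ∧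
      (convFactor (iterMatrix A' (gaussSeidelM A')) ≥ convFactor (iterMatrix A' (stairSecondM A')) ∧
        convFactor (iterMatrix A' (stairSecondM A')) ≥
          convFactor (iterMatrix A' (antiGaussSeidelM A'))) := by
  refine ⟨exists_isNormalization hM hirr hsing, fun A' hA' => ?_⟩
  have hirr' : IsIrreducible A' := fun S hS hS' => by
    obtain ⟨i, j, hi, hj, hij⟩ := hirr S hS hS'
    exact ⟨i, j, hi, hj, (hA'.apply_ne_zero_iff i j).mpr hij⟩
  have hsum := hA'.sum_eq_zero
  have hB : IsNonsingularMMatrix (leading A') :=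
    isNonsingularMMatrix_leading hirr' (fun _ _ => hA'.nonpos_of_ne) hsum
  have hH : ∀ i j : Fin m, leading A' i j ≠ 0 → j.val ≤ i.val + 1 := fun i j hij => by
    by_contra! h
    exact (hA'.apply_ne_zero_iff _ _).mp hij (hHess i.castSucc j.castSucc h)
  simp only [jacobiM, gaussSeidelM, stairFirstM, stairSecondM, antiGaussSeidelM,
    diagonal_diag_eq_maskPart, tril_eq_maskPart, triu_eq_maskPart, stairFirst_eq_maskPart,
    stairSecond_eq_maskPart, ge_iff_le]
  refine ⟨⟨?_, ?_, ?_, ?_, ?_⟩, ⟨?_, ?_, ?_⟩, ?_, ?_⟩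
  iterate 5 exact isUnit_liftM (hB.isUnit_maskPart fun i => by simp)
  · refine convFactor_iterMatrix_liftM_le hsum hB (by simp) (by simp) (fun _ => 0) ?_
    intro i j hij _
    simp [hij]
  -- The entry `(i, i + 1)` allows `a` to grow from `i` to `i + 1` by the exponent of the first
  -- splitting minus that of the second, which is `0` and `1` in alternate rows: hence the halves
  -- below. The entries `(i + 1, i)` then satisfy the condition with equality, and those further
  -- below the diagonal satisfy it because `a` grows by at least one in two steps.
  · refine convFactor_iterMatrix_liftM_le hsum hB (by simp) (by simp) (fun i => i.val / 2) ?_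
    intro i j hij h
    have := hH i j h
    simp only [Fin.ext_iff, Fin.le_def, Nat.even_iff] at hij ⊢
    split_ifs <;> omega
  · refine convFactor_iterMatrix_liftM_le hsum hB (by simp) (by simp) (fun i => (i.val + 1) / 2) ?_
    intro i j hij h
    have := hH i j h
    simp only [Fin.ext_iff, Fin.le_def, Nat.even_iff] at hij ⊢
    split_ifs <;> omega
  · refine convFactor_iterMatrix_liftM_le hsum hB (by simp) (by simp) (fun i => (i.val + 1) / 2) ?_
    intro i j hij h
    have := hH i j h
    simp only [Fin.ext_iff, Fin.le_def, Nat.odd_iff] at hij ⊢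
    split_ifs <;> omega
  · refine convFactor_iterMatrix_liftM_le hsum hB (by simp) (by simp) (fun i => i.val / 2) ?_
    intro i j hij h
    have := hH i j h
    simp only [Fin.ext_iff, Fin.le_def, Nat.odd_iff] at hij ⊢
    split_ifs <;> omega
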